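/- **Theorem 1.1.** Let $n\ge 2$ be an integer. Consider closed $n$-gons in the real projective plane $\mathbb{RP}^2$: one given by its vertices, points $A_1,\dots,A_n\in\mathbb{RP}^2$, and one given by its edges, lines $b_1,\dots,b_n\subset\mathbb{RP}^2$, with all indices taken mod $n$. Put $a_i:=A_iA_{i+1}$ (the line through $A_i$ and $A_{i+1}$) and $B_i:=b_i\cap b_{i+1}$. The pair is - *inscribed* if $B_i\in a_i$ for all $i$; - *non-degenerate* if, for all $i$, $A_i\notin b_i$, the points $A_i,A_{i+1},A_{i+2}$ are non-collinear, and the lines $b_i,b_{i+1},b_{i+2}$ are non-concurrent; - *dancing* if it is inscribed and, for all $i$, $$[A_{i+1},B_i,A_i,D]+[A_{i+1},B_{i+1},A_{i+2},C]=0,\qquad C:=b_i\cap a_{i+1},\quad D:=a_i\cap b_{i+2},$$ where the cross-ratio of four collinear points is $[P_1,P_2,P_3,P_4]=\dfrac{(x_1-x_3)(x_2-x_4)}{(x_1-x_4)(x_2-x_3)}$, with $x_j$ the value at $P_j$ of an affine coordinate on their common line. (For a non-degenerate inscribed pair, all these lines, points and cross-ratios are well defined.) Then a non-degenerate dancing pair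 of closed $n$-gons exists if and only if $n\ge 6$. -/

import Mathlib

open scoped LinearAlgebra.Projectivization Matrix

namespace DancingPairs

/-- Points of the real projective plane, given by homogeneous column coordinates in `ℝ³`. -/
abbrev Point : Type := ℙ ℝ (Fin 3 → ℝ)

/-- Lines of the real projective plane (points of the dual plane), given by homogeneous row
coordinates: the line `[b]` is `{[A] | b A = 0}`. -/
abbrev Line : Type := ℙ ℝ (Fin 3 → ℝ)

/-- The point `P` lies on the line `l`. -/
def OnLine (P : Point) (l : Line) : Prop := Projectivization.orthogonal P l

/-- The line through `P` and `Q` (meaningful for `P ≠ Q`). -/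
noncomputable def join (P Q : Point) : Line := Projectivization.cross P Q

/-- The intersection point of `l` and `m` (meaningful for `l ≠ m`). -/
noncomputable def meet (l m : Line) : Point := Projectivization.cross l m

/-- For points `P = [u]`, `Q = [v]` of the line `l = [w]`, the determinant `det (w, u, v)`. Since
the vector `w` is not in the plane `{z | w ⬝ᵥ z = 0}` of vectors representing points of `l`, this is
an area form of that plane, evaluated on the representatives of `P` and `Q`. -/
noncomputable def bracket (l : Line) (P Q : Point) : ℝ := l.rep ⬝ᵥ (P.rep ⨯₃ Q.rep)

/-- The cross-ratio `(x₁ - x₃) (x₂ - x₄) / ((x₁ - x₄) (x₂ - x₃))` of four points of the line `l`,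
in homogeneous form, so that no point has to be finite. It does not depend on the representatives,
and it is the usual expression in every affine coordinate `x` of `l`: see
`crossRatio_eq_affine`. -/
noncomputable def crossRatio (l : Line) (P₁ P₂ P₃ P₄ : Point) : ℝ :=
  (bracket l P₁ P₃ * bracket l P₂ P₄) / (bracket l P₁ P₄ * bracket l P₂ P₃)

/-- The affine coordinate `(f ⬝ᵥ z) / (g ⬝ᵥ z)` of the point `[z]`. -/
noncomputable def affineCoord (f g : Fin 3 → ℝ) (P : Point) : ℝ :=
  (f ⬝ᵥ P.rep) / (g ⬝ᵥ P.rep)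

theorem onLine_rep {P : Point} {l : Line} (h : OnLine P l) : P.rep ⬝ᵥ l.rep = 0 := by
  have h' := h
  rw [OnLine, ← P.mk_rep, ← l.mk_rep, Projectivization.orthogonal_mk] at h'
  exact h'

theorem affineCoord_sub {l : Line} {P Q : Point} {f g : Fin 3 → ℝ}
    (hP : OnLine P l) (hQ : OnLine Q l) (gP : g ⬝ᵥ P.rep ≠ 0) (gQ : g ⬝ᵥ Q.rep ≠ 0) :
    (l.rep ⬝ᵥ l.rep) * ((affineCoord f g P - affineCoord f g Q) *
      ((g ⬝ᵥ P.rep) * (g ⬝ᵥ Q.rep))) = (l.rep ⬝ᵥ (f ⨯₃ g)) * bracket l P Q := by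
  have h1 := onLine_rep hP
  have h2 := onLine_rep hQ
  have e : (affineCoord f g P - affineCoord f g Q) * ((g ⬝ᵥ P.rep) * (g ⬝ᵥ Q.rep)) =
      (f ⨯₃ g) ⬝ᵥ (P.rep ⨯₃ Q.rep) := by
    rw [cross_dot_cross]
    unfold affineCoord
    field_simp
  have z : l.rep ⨯₃ (P.rep ⨯₃ Q.rep) = 0 := by
    simp only [dotProduct, Fin.sum_univ_three] at h1 h2
    ext i
    fin_cases i <;> simp [cross_apply] <;> grind
  have k : (l.rep ⨯₃ (f ⨯₃ g)) ⬝ᵥ (l.rep ⨯₃ (P.rep ⨯₃ Q.rep)) = 0 := by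
    rw [z, dotProduct_zero]
  rw [cross_dot_cross] at k
  rw [e, bracket, dotProduct_comm l.rep (f ⨯₃ g), mul_comm (_ ⬝ᵥ _) (l.rep ⬝ᵥ _)]
  rw [dotProduct_comm (f ⨯₃ g) l.rep] at *
  linarith

/-- In an affine coordinate `x` of the line `l` in which the four points are finite, the cross-ratio
is the usual expression. (An affine coordinate is a quotient of two linear forms `f`, `g` that are
linearly independent on `l`.) -/
theorem crossRatio_eq_affine {l : Line} {P₁ P₂ P₃ P₄ : Point} {f g : Fin 3 → ℝ}
    (h₁ : OnLine P₁ l) (h₂ : OnLine P₂ l) (h₃ : OnLine P₃ l) (h₄ : OnLine P₄ l)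
    (hfg : l.rep ⬝ᵥ (f ⨯₃ g) ≠ 0)
    (g₁ : g ⬝ᵥ P₁.rep ≠ 0) (g₂ : g ⬝ᵥ P₂.rep ≠ 0) (g₃ : g ⬝ᵥ P₃.rep ≠ 0)
    (g₄ : g ⬝ᵥ P₄.rep ≠ 0) :
    crossRatio l P₁ P₂ P₃ P₄ =
      ((affineCoord f g P₁ - affineCoord f g P₃) * (affineCoord f g P₂ - affineCoord f g P₄)) /
      ((affineCoord f g P₁ - affineCoord f g P₄) * (affineCoord f g P₂ - affineCoord f g P₃)) := by
  have hw : l.rep ⬝ᵥ l.rep ≠ 0 := by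
    rw [ne_eq, dotProduct_self_eq_zero]
    exact l.rep_nonzero
  have key : ∀ {P Q : Point}, OnLine P l → OnLine Q l → g ⬝ᵥ P.rep ≠ 0 → g ⬝ᵥ Q.rep ≠ 0 →
      bracket l P Q = (l.rep ⬝ᵥ l.rep) / (l.rep ⬝ᵥ (f ⨯₃ g)) *
        ((affineCoord f g P - affineCoord f g Q) * ((g ⬝ᵥ P.rep) * (g ⬝ᵥ Q.rep))) := by
    intro P Q hP hQ gP gQ
    rw [div_mul_eq_mul_div, affineCoord_sub hP hQ gP gQ, mul_div_cancel_left₀ _ hfg]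
  rw [crossRatio, key h₁ h₃ g₁ g₃, key h₂ h₄ g₂ g₄, key h₁ h₄ g₁ g₄, key h₂ h₃ g₂ g₃]
  generalize affineCoord f g P₁ - affineCoord f g P₃ = x
  generalize affineCoord f g P₂ - affineCoord f g P₄ = y
  generalize affineCoord f g P₁ - affineCoord f g P₄ = z
  generalize affineCoord f g P₂ - affineCoord f g P₃ = t
  have hc : (l.rep ⬝ᵥ l.rep) / (l.rep ⬝ᵥ (f ⨯₃ g)) ≠ 0 := div_ne_zero hw hfg
  generalize (l.rep ⬝ᵥ l.rep) / (l.rep ⬝ᵥ (f ⨯₃ g)) = c at *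
  have hk : c * c * ((g ⬝ᵥ P₁.rep) * (g ⬝ᵥ P₂.rep) * (g ⬝ᵥ P₃.rep) * (g ⬝ᵥ P₄.rep)) ≠ 0 := by
    simp [hc, g₁, g₂, g₃, g₄]
  rw [← mul_div_mul_left (x * y) (z * t) hk]
  congr 1 <;> ring

section Polygons

variable {n : ℕ}

/-- The edge `a i = A i A (i + 1)` of the closed polygon with vertices `A i`, with indices mod `n`. -/
noncomputable def edge (A : ZMod n → Point) (i : ZMod n) : Line := join (A i) (A (i + 1))

/-- The vertex `B i = b i ∩ b (i + 1)` of the closed polygon with edges `b i`. -/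
noncomputable def vertex (b : ZMod n → Line) (i : ZMod n) : Point := meet (b i) (b (i + 1))

/-- The closed `n`-gon with edges `b i` is inscribed in the closed `n`-gon with vertices `A i`. -/
def IsInscribed (A : ZMod n → Point) (b : ZMod n → Line) : Prop :=
  ∀ i, OnLine (vertex b i) (edge A i)

/-- Non-degeneracy: no `A i` lies on `b i`, no three consecutive vertices `A i` are collinear, and
no three consecutive edges `b i` are concurrent. -/
structure IsNondegenerate (A : ZMod n → Point) (b : ZMod n → Line) : Prop where
  not_onLine : ∀ i, ¬ OnLine (A i) (b i)
  not_collinear : ∀ i, ¬ ∃ l : Line, OnLine (A i) l ∧ OnLine (A (i + 1)) l ∧ OnLine (A (i + 2)) l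
  not_concurrent : ∀ i, ¬ ∃ P : Point, OnLine P (b i) ∧ OnLine P (b (i + 1)) ∧ OnLine P (b (i + 2))

/-- The pair is dancing: it is inscribed, and at each vertex `A (i + 1)` of the circumscribing
polygon `[A (i + 1), B i, A i, D] + [A (i + 1), B (i + 1), A (i + 2), C] = 0`, where
`C = b i ∩ a (i + 1)` and `D = a i ∩ b (i + 2)`. The first four points are on `a i`, the other four
on `a (i + 1)`. -/
structure IsDancing (A : ZMod n → Point) (b : ZMod n → Line) : Prop where
  inscribed : IsInscribed A b
  dancing : ∀ i,
    crossRatio (edge A i) (A (i + 1)) (vertex b i) (A i) (meet (edge A i) (b (i + 2))) +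
      crossRatio (edge A (i + 1)) (A (i + 1)) (vertex b (i + 1)) (A (i + 2))
        (meet (b i) (edge A (i + 1))) = 0

end Polygons

end DancingPairs

/-!
Let `u i` and `w i` be homogeneous coordinates of the vertices `A i` and the edges `b i`. In terms
of the pairings `w i ⬝ᵥ u j` the inscription condition is `p₀₀ p₁₁ = p₀₁ p₁₀`, so that the
coordinates can be rescaled, along the universal cover of the index set, to make all the pairings
of equal or adjacent indices equal to `1`. After that the dancing condition becomes
`W k ⬝ᵥ U (k + 2) + W (k + 2) ⬝ᵥ U k = 2`, and non-degeneracy becomes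
`x k := W k ⬝ᵥ U (k + 2) - 1 ≠ 0`.

Non-existence for `n ≤ 5`. Closing up gives `U (k + n) = c • U k` and `W (k + n) = c⁻¹ • W k`. The
determinants of consecutive triples of vertices are proportional to `x k`
(`IsNormalized.points_mul`), hence `c ^ 3 = 1` and `c = 1`. Since four vectors in `ℝ³` are linearly
dependent, `W 0 ⬝ᵥ U 3 + W 3 ⬝ᵥ U 0 = 2 + x 0 * x 1 ≠ 2` (`IsNormalized.pair_add_three`). But if
the period is at most `5`, then indices at distance three are at cyclic distance at most two, and
this sum is `2`.

Existence for `n ≥ 6`. All conditions involve three consecutive indices only, so two normalized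
closed polygon pairs with the same first two vertices and edges can be traversed one after the
other. It is therefore enough to have examples for `n = 6, …, 11` with a common beginning; they are
written as words in thirteen integral flags (`exists_closed_word`).
-/

namespace DancingPairs

open Projectivization

/-! ### Homogeneous coordinates -/

section Coordinates

variable {u v t m m' : Fin 3 → ℝ}

/-- Three points are collinear if and only if their determinant vanishes. -/
theorem exists_onLine_iff (hu : u ≠ 0) (hv : v ≠ 0) (ht : t ≠ 0) :
    (∃ l : Line, OnLine (mk ℝ u hu) l ∧ OnLine (mk ℝ v hv) l ∧ OnLine (mk ℝ t ht) l) ↔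
      u ⬝ᵥ v ⨯₃ t = 0 := by
  rw [triple_product_eq_det]
  refine Iff.trans ?_ (Matrix.exists_mulVec_eq_zero_iff (M := Matrix.of ![u, v, t]))
  constructor
  · rintro ⟨l, h₁, h₂, h₃⟩
    induction l using Projectivization.ind with | h l hl =>
    refine ⟨l, hl, ?_⟩
    ext i
    fin_cases i
    exacts [h₁, h₂, h₃]
  · rintro ⟨l, hl, h⟩
    exact ⟨mk ℝ l hl, congrFun h 0, congrFun h 1, congrFun h 2⟩

/-- Three lines are concurrent if and only if their determinant vanishes. -/
theorem exists_point_onLine_iff (hu : u ≠ 0) (hv : v ≠ 0) (ht : t ≠ 0) :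
    (∃ P : Point, OnLine P (mk ℝ u hu) ∧ OnLine P (mk ℝ v hv) ∧ OnLine P (mk ℝ t ht)) ↔
      u ⬝ᵥ v ⨯₃ t = 0 := by
  simp only [← exists_onLine_iff hu hv ht, OnLine]
  refine exists_congr fun P => ?_
  rw [orthogonal_comm, orthogonal_comm (v := P) (w := mk ℝ v hv),
    orthogonal_comm (v := P) (w := mk ℝ t ht)]

/-- The cross-ratio may be computed with arbitrary homogeneous coordinates. -/
theorem crossRatio_mk {l p₁ p₂ p₃ p₄ : Fin 3 → ℝ} (hl : l ≠ 0) (h₁ : p₁ ≠ 0) (h₂ : p₂ ≠ 0)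
    (h₃ : p₃ ≠ 0) (h₄ : p₄ ≠ 0) :
    crossRatio (mk ℝ l hl) (mk ℝ p₁ h₁) (mk ℝ p₂ h₂) (mk ℝ p₃ h₃) (mk ℝ p₄ h₄) =
      ((l ⬝ᵥ p₁ ⨯₃ p₃) * (l ⬝ᵥ p₂ ⨯₃ p₄)) / ((l ⬝ᵥ p₁ ⨯₃ p₄) * (l ⬝ᵥ p₂ ⨯₃ p₃)) := by
  obtain ⟨a, ha⟩ := exists_smul_eq_mk_rep ℝ l hl
  obtain ⟨a₁, ha₁⟩ := exists_smul_eq_mk_rep ℝ p₁ h₁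
  obtain ⟨a₂, ha₂⟩ := exists_smul_eq_mk_rep ℝ p₂ h₂
  obtain ⟨a₃, ha₃⟩ := exists_smul_eq_mk_rep ℝ p₃ h₃
  obtain ⟨a₄, ha₄⟩ := exists_smul_eq_mk_rep ℝ p₄ h₄
  simp only [crossRatio, bracket, ← ha, ← ha₁, ← ha₂, ← ha₃, ← ha₄, Units.smul_def, map_smul,
    LinearMap.smul_apply, dotProduct_smul, smul_dotProduct, smul_eq_mul]
  have hk : (a * a * a₁ * a₂ * a₃ * a₄ : ℝ) ≠ 0 := by simp
  rw [← mul_div_mul_left ((l ⬝ᵥ p₁ ⨯₃ p₃) * (l ⬝ᵥ p₂ ⨯₃ p₄)) _ hk]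
  congr 1 <;> ring

theorem join_mk (hu : u ≠ 0) (hv : v ≠ 0) (h : u ⨯₃ v ≠ 0) :
    join (mk ℝ u hu) (mk ℝ v hv) = mk ℝ (u ⨯₃ v) h :=
  cross_mk_of_cross_ne_zero hu hv h

theorem meet_mk (hu : u ≠ 0) (hv : v ≠ 0) (h : u ⨯₃ v ≠ 0) :
    meet (mk ℝ u hu) (mk ℝ v hv) = mk ℝ (u ⨯₃ v) h :=
  cross_mk_of_cross_ne_zero hu hv h

theorem cross_cross_ne_zero (h : u ⨯₃ v ≠ 0) (hm : m ⬝ᵥ u ≠ 0) : u ⨯₃ v ⨯₃ m ≠ 0 := by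
  intro h0
  have e : u ⨯₃ (u ⨯₃ v ⨯₃ m) = (m ⬝ᵥ u) • u ⨯₃ v := by
    rw [cross_cross_eq_smul_sub_smul', dotProduct_comm _ u, dot_self_cross, zero_smul, sub_zero,
      dotProduct_comm]
  rw [h0, map_zero] at e
  exact smul_ne_zero hm h e.symm

/-- The cross-ratio of the point `[v]`, the intersection of the line `[u][v]` with `[m]`, the point
`[u]`, and the intersection of `[u][v]` with `[m']`. -/
theorem crossRatio_join_meet (hu : u ≠ 0) (hv : v ≠ 0) (hm : m ≠ 0) (hm' : m' ≠ 0)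
    (h : u ⨯₃ v ≠ 0) (hmu : m ⬝ᵥ u ≠ 0) (hmv : m' ⬝ᵥ v ≠ 0) :
    crossRatio (join (mk ℝ u hu) (mk ℝ v hv)) (mk ℝ v hv)
        (meet (join (mk ℝ u hu) (mk ℝ v hv)) (mk ℝ m hm)) (mk ℝ u hu)
        (meet (join (mk ℝ u hu) (mk ℝ v hv)) (mk ℝ m' hm')) =
      1 - (m' ⬝ᵥ u) * (m ⬝ᵥ v) / ((m' ⬝ᵥ v) * (m ⬝ᵥ u)) := by
  have h' : v ⨯₃ u ≠ 0 := by rwa [← cross_anticomm, neg_ne_zero]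
  have h₄ : u ⨯₃ v ⨯₃ m' ≠ 0 := by
    rw [← cross_anticomm v u, map_neg, LinearMap.neg_apply, neg_ne_zero]
    exact cross_cross_ne_zero h' hmv
  have hll : u ⨯₃ v ⬝ᵥ u ⨯₃ v ≠ 0 := by rwa [ne_eq, dotProduct_self_eq_zero]
  rw [join_mk hu hv h, meet_mk h hm (cross_cross_ne_zero h hmu), meet_mk h hm' h₄, crossRatio_mk]
  have e₁ : u ⨯₃ v ⬝ᵥ v ⨯₃ u = -(u ⨯₃ v ⬝ᵥ u ⨯₃ v) := by
    rw [← cross_anticomm u v, dotProduct_neg]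
  have e₂ : ∀ k, u ⨯₃ v ⬝ᵥ v ⨯₃ (u ⨯₃ v ⨯₃ k) = (u ⨯₃ v ⬝ᵥ u ⨯₃ v) * (k ⬝ᵥ v) := by
    intro k
    rw [cross_cross_eq_smul_sub_smul', dotProduct_comm _ v, dot_cross_self, zero_smul, sub_zero,
      dotProduct_smul, smul_eq_mul, mul_comm, dotProduct_comm k v]
  have e₃ : ∀ k, u ⨯₃ v ⬝ᵥ (u ⨯₃ v ⨯₃ k) ⨯₃ u = -((u ⨯₃ v ⬝ᵥ u ⨯₃ v) * (k ⬝ᵥ u)) := by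
    intro k
    rw [← cross_anticomm u (u ⨯₃ v ⨯₃ k), cross_cross_eq_smul_sub_smul', dotProduct_comm _ u,
      dot_self_cross, zero_smul, sub_zero, dotProduct_neg, dotProduct_smul, smul_eq_mul, mul_comm,
      dotProduct_comm k u]
  have e₄ : u ⨯₃ v ⬝ᵥ (u ⨯₃ v ⨯₃ m) ⨯₃ (u ⨯₃ v ⨯₃ m') =
      (u ⨯₃ v ⬝ᵥ u ⨯₃ v) * ((m ⬝ᵥ u) * (m' ⬝ᵥ v) - (m ⬝ᵥ v) * (m' ⬝ᵥ u)) := by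
    simp only [cross_apply, dotProduct, Fin.sum_univ_three, Matrix.cons_val]
    ring
  rw [e₁, e₂, e₃, e₄]
  field_simp

/-- If the intersection point of two lines lies on the line `[u][v]`, it is also the intersection of
`[u][v]` with the first of them. -/
theorem meet_eq_meet_join {w : Fin 3 → ℝ} (hu : u ≠ 0) (hv : v ≠ 0) (hm : m ≠ 0) (hw : w ≠ 0)
    (h : u ⨯₃ v ≠ 0) (hmw : m ⨯₃ w ≠ 0) (hmu : m ⬝ᵥ u ≠ 0)
    (hon : OnLine (meet (mk ℝ m hm) (mk ℝ w hw)) (join (mk ℝ u hu) (mk ℝ v hv))) :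
    meet (mk ℝ m hm) (mk ℝ w hw) = meet (join (mk ℝ u hu) (mk ℝ v hv)) (mk ℝ m hm) := by
  have n₁ : mk ℝ m hm ≠ mk ℝ w hw := by rwa [ne_eq, mk_eq_mk_iff_crossProduct_eq_zero]
  have n₂ : join (mk ℝ u hu) (mk ℝ v hv) ≠ mk ℝ m hm := by
    rw [join_mk hu hv h, ne_eq, mk_eq_mk_iff_crossProduct_eq_zero]
    exact cross_cross_ne_zero h hmu
  exact (Configuration.ofField.eq_or_eq_of_orthogonal hon (cross_orthogonal_left n₂)
    (cross_orthogonal_left n₁) (cross_orthogonal_right n₂)).resolve_right n₂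

theorem onLine_meet_join_iff {w : Fin 3 → ℝ} (hu : u ≠ 0) (hv : v ≠ 0) (hm : m ≠ 0) (hw : w ≠ 0)
    (h : u ⨯₃ v ≠ 0) (hmw : m ⨯₃ w ≠ 0) :
    OnLine (meet (mk ℝ m hm) (mk ℝ w hw)) (join (mk ℝ u hu) (mk ℝ v hv)) ↔
      (m ⬝ᵥ u) * (w ⬝ᵥ v) = (m ⬝ᵥ v) * (w ⬝ᵥ u) := by
  rw [join_mk hu hv h, meet_mk hm hw hmw, OnLine, orthogonal_mk, cross_dot_cross, sub_eq_zero]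

theorem cross_ne_zero_of_triple_left (h : u ⬝ᵥ v ⨯₃ t ≠ 0) : u ⨯₃ v ≠ 0 := by
  rintro h0
  rw [triple_product_permutation, triple_product_permutation, h0, dotProduct_zero] at h
  exact h rfl

theorem cross_ne_zero_of_triple_right (h : u ⬝ᵥ v ⨯₃ t ≠ 0) : v ⨯₃ t ≠ 0 := by
  rintro h0
  rw [h0, dotProduct_zero] at h
  exact h rfl

end Coordinates

/-- The conditions defining a non-degenerate dancing pair, restricted to three consecutive vertices
`[u₀], [u₁], [u₂]` and edges `[w₀], [w₁], [w₂]`, in homogeneous coordinates. -/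
structure IsDancingTriple (u₀ u₁ u₂ w₀ w₁ w₂ : Fin 3 → ℝ) : Prop where
  ne₀ : w₀ ⬝ᵥ u₀ ≠ 0
  ne₁ : w₁ ⬝ᵥ u₁ ≠ 0
  ne₂ : w₂ ⬝ᵥ u₂ ≠ 0
  points : u₀ ⬝ᵥ u₁ ⨯₃ u₂ ≠ 0
  lines : w₀ ⬝ᵥ w₁ ⨯₃ w₂ ≠ 0
  inscribed₀ : (w₀ ⬝ᵥ u₀) * (w₁ ⬝ᵥ u₁) = (w₀ ⬝ᵥ u₁) * (w₁ ⬝ᵥ u₀)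
  inscribed₁ : (w₁ ⬝ᵥ u₁) * (w₂ ⬝ᵥ u₂) = (w₁ ⬝ᵥ u₂) * (w₂ ⬝ᵥ u₁)
  dancing : (w₂ ⬝ᵥ u₀) * (w₀ ⬝ᵥ u₁) / ((w₂ ⬝ᵥ u₁) * (w₀ ⬝ᵥ u₀)) +
    (w₀ ⬝ᵥ u₂) * (w₂ ⬝ᵥ u₁) / ((w₀ ⬝ᵥ u₁) * (w₂ ⬝ᵥ u₂)) = 2

/-- The left-hand side of the dancing condition in homogeneous coordinates. -/
theorem crossRatio_add_crossRatio {u₀ u₁ u₂ w₀ w₁ w₂ : Fin 3 → ℝ}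
    (hu₀ : u₀ ≠ 0) (hu₁ : u₁ ≠ 0) (hu₂ : u₂ ≠ 0) (hw₀ : w₀ ≠ 0) (hw₁ : w₁ ≠ 0) (hw₂ : w₂ ≠ 0)
    (ne₀ : w₀ ⬝ᵥ u₀ ≠ 0) (ne₁ : w₁ ⬝ᵥ u₁ ≠ 0) (ne₂ : w₂ ⬝ᵥ u₂ ≠ 0)
    (hu : u₀ ⬝ᵥ u₁ ⨯₃ u₂ ≠ 0) (hw : w₀ ⬝ᵥ w₁ ⨯₃ w₂ ≠ 0)
    (i₀ : (w₀ ⬝ᵥ u₀) * (w₁ ⬝ᵥ u₁) = (w₀ ⬝ᵥ u₁) * (w₁ ⬝ᵥ u₀))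
    (i₁ : (w₁ ⬝ᵥ u₁) * (w₂ ⬝ᵥ u₂) = (w₁ ⬝ᵥ u₂) * (w₂ ⬝ᵥ u₁)) :
    crossRatio (join (mk ℝ u₀ hu₀) (mk ℝ u₁ hu₁)) (mk ℝ u₁ hu₁)
        (meet (mk ℝ w₀ hw₀) (mk ℝ w₁ hw₁)) (mk ℝ u₀ hu₀)
        (meet (join (mk ℝ u₀ hu₀) (mk ℝ u₁ hu₁)) (mk ℝ w₂ hw₂)) +
      crossRatio (join (mk ℝ u₁ hu₁) (mk ℝ u₂ hu₂)) (mk ℝ u₁ hu₁)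
        (meet (mk ℝ w₁ hw₁) (mk ℝ w₂ hw₂)) (mk ℝ u₂ hu₂)
        (meet (mk ℝ w₀ hw₀) (join (mk ℝ u₁ hu₁) (mk ℝ u₂ hu₂))) =
      2 - ((w₂ ⬝ᵥ u₀) * (w₀ ⬝ᵥ u₁) / ((w₂ ⬝ᵥ u₁) * (w₀ ⬝ᵥ u₀)) +
        (w₀ ⬝ᵥ u₂) * (w₂ ⬝ᵥ u₁) / ((w₀ ⬝ᵥ u₁) * (w₂ ⬝ᵥ u₂))) := by
  have hu₀₁ := cross_ne_zero_of_triple_left hu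
  have hu₁₂ := cross_ne_zero_of_triple_right hu
  have hw₀₁ := cross_ne_zero_of_triple_left hw
  have hw₁₂ := cross_ne_zero_of_triple_right hw
  have hu₂₁ : u₂ ⨯₃ u₁ ≠ 0 := by rwa [← cross_anticomm, neg_ne_zero]
  have hw₂₁ : w₂ ⨯₃ w₁ ≠ 0 := by rwa [← cross_anticomm, neg_ne_zero]
  have h₀₁ : w₀ ⬝ᵥ u₁ ≠ 0 := fun h => mul_ne_zero ne₀ ne₁ (by rw [i₀, h, zero_mul])
  have h₂₁ : w₂ ⬝ᵥ u₁ ≠ 0 := fun h => mul_ne_zero ne₁ ne₂ (by rw [i₁, h, mul_zero])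
  -- Both cross-ratios have the form of `crossRatio_join_meet`; for the second one the line has to be
  -- read from `[u₂]` to `[u₁]`, so that the common vertex `[u₁]` is the first of the four points.
  rw [meet_eq_meet_join hu₀ hu₁ hw₀ hw₁ hu₀₁ hw₀₁ ne₀
      ((onLine_meet_join_iff hu₀ hu₁ hw₀ hw₁ hu₀₁ hw₀₁).mpr i₀),
    crossRatio_join_meet hu₀ hu₁ hw₀ hw₂ hu₀₁ ne₀ h₂₁,
    show join (mk ℝ u₁ hu₁) (mk ℝ u₂ hu₂) = join (mk ℝ u₂ hu₂) (mk ℝ u₁ hu₁) from cross_comm _ _,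
    show meet (mk ℝ w₁ hw₁) (mk ℝ w₂ hw₂) = meet (mk ℝ w₂ hw₂) (mk ℝ w₁ hw₁) from cross_comm _ _,
    show meet (mk ℝ w₀ hw₀) (join (mk ℝ u₂ hu₂) (mk ℝ u₁ hu₁)) =
      meet (join (mk ℝ u₂ hu₂) (mk ℝ u₁ hu₁)) (mk ℝ w₀ hw₀) from cross_comm _ _,
    meet_eq_meet_join hu₂ hu₁ hw₂ hw₁ hu₂₁ hw₂₁ ne₂
      ((onLine_meet_join_iff hu₂ hu₁ hw₂ hw₁ hu₂₁ hw₂₁).mpr (by linear_combination i₁)),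
    crossRatio_join_meet hu₂ hu₁ hw₂ hw₀ hu₂₁ ne₂ h₀₁]
  ring

/-- A pair of polygons given by homogeneous coordinates is non-degenerate and dancing if and only if
all its triples of consecutive vertices and edges are dancing triples. -/
theorem isNondegenerate_and_isDancing_iff {n : ℕ} (u w : ZMod n → Fin 3 → ℝ)
    (hu : ∀ i, u i ≠ 0) (hw : ∀ i, w i ≠ 0) :
    (IsNondegenerate (fun i => mk ℝ (u i) (hu i)) (fun i => mk ℝ (w i) (hw i)) ∧
      IsDancing (fun i => mk ℝ (u i) (hu i)) (fun i => mk ℝ (w i) (hw i))) ↔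
    ∀ i, IsDancingTriple (u i) (u (i + 1)) (u (i + 2)) (w i) (w (i + 1)) (w (i + 2)) := by
  have e : ∀ i : ZMod n, i + 1 + 1 = i + 2 := fun i => by ring
  constructor
  · rintro ⟨hN, hD⟩ i
    have ne : ∀ i, w i ⬝ᵥ u i ≠ 0 := fun i h => hN.not_onLine i (by
      rwa [OnLine, orthogonal_mk, dotProduct_comm])
    have hU : ∀ i, u i ⬝ᵥ u (i + 1) ⨯₃ u (i + 2) ≠ 0 := fun i h =>
      hN.not_collinear i ((exists_onLine_iff (hu _) (hu _) (hu _)).mpr h)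
    have hW : ∀ i, w i ⬝ᵥ w (i + 1) ⨯₃ w (i + 2) ≠ 0 := fun i h =>
      hN.not_concurrent i ((exists_point_onLine_iff (hw _) (hw _) (hw _)).mpr h)
    have hI : ∀ i, (w i ⬝ᵥ u i) * (w (i + 1) ⬝ᵥ u (i + 1)) =
        (w i ⬝ᵥ u (i + 1)) * (w (i + 1) ⬝ᵥ u i) := fun i =>
      (onLine_meet_join_iff (hu _) (hu _) (hw _) (hw _) (cross_ne_zero_of_triple_left (hU i))
        (cross_ne_zero_of_triple_left (hW i))).mp (hD.inscribed i)
    have hI' := hI (i + 1)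
    rw [e] at hI'
    have hd := hD.dancing i
    simp only [edge, vertex, e] at hd
    rw [crossRatio_add_crossRatio (hu _) (hu _) (hu _) (hw _) (hw _) (hw _) (ne _) (ne _) (ne _)
      (hU i) (hW i) (hI i) hI'] at hd
    exact ⟨ne _, ne _, ne _, hU i, hW i, hI i, hI', by linarith⟩
  · intro h
    refine ⟨⟨fun i hi => (h i).ne₀ ?_, fun i hi => (h i).points ?_, fun i hi => (h i).lines ?_⟩,
      ⟨fun i => ?_, fun i => ?_⟩⟩
    · rwa [OnLine, orthogonal_mk, dotProduct_comm] at hi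
    · exact (exists_onLine_iff (hu _) (hu _) (hu _)).mp hi
    · exact (exists_point_onLine_iff (hw _) (hw _) (hw _)).mp hi
    · exact (onLine_meet_join_iff (hu _) (hu _) (hw _) (hw _)
        (cross_ne_zero_of_triple_left (h i).points)
        (cross_ne_zero_of_triple_left (h i).lines)).mpr (h i).inscribed₀
    · simp only [edge, vertex, e]
      rw [crossRatio_add_crossRatio (hu _) (hu _) (hu _) (hw _) (hw _) (hw _) (h i).ne₀ (h i).ne₁
        (h i).ne₂ (h i).points (h i).lines (h i).inscribed₀ (h i).inscribed₁, (h i).dancing,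
        sub_self]

/-! ### Non-existence for at most five sides -/

/-- The product of two `3 × 3` determinants is the determinant of the matrix of dot products. -/
theorem triple_mul_triple (a b c x y z : Fin 3 → ℝ) :
    (a ⬝ᵥ b ⨯₃ c) * (x ⬝ᵥ y ⨯₃ z) =
      (a ⬝ᵥ x) * ((b ⬝ᵥ y) * (c ⬝ᵥ z) - (b ⬝ᵥ z) * (c ⬝ᵥ y)) -
      (a ⬝ᵥ y) * ((b ⬝ᵥ x) * (c ⬝ᵥ z) - (b ⬝ᵥ z) * (c ⬝ᵥ x)) +
      (a ⬝ᵥ z) * ((b ⬝ᵥ x) * (c ⬝ᵥ y) - (b ⬝ᵥ y) * (c ⬝ᵥ x)) := by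
  simp only [cross_apply, dotProduct, Fin.sum_univ_three, Matrix.cons_val]
  ring

/-- Homogeneous coordinates of the vertices and edges of a non-degenerate dancing pair, indexed by
the universal cover `ℕ` of the index set and scaled so that the pairings of each edge with the
vertices of equal and adjacent index are `1`. After this scaling, the dancing condition is linear
in the pairings. -/
structure IsNormalized (U W : ℕ → Fin 3 → ℝ) : Prop where
  pair_self : ∀ k, W k ⬝ᵥ U k = 1
  pair_succ : ∀ k, W k ⬝ᵥ U (k + 1) = 1
  succ_pair : ∀ k, W (k + 1) ⬝ᵥ U k = 1
  add_eq_two : ∀ k, W k ⬝ᵥ U (k + 2) + W (k + 2) ⬝ᵥ U k = 2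
  points : ∀ k, U k ⬝ᵥ U (k + 1) ⨯₃ U (k + 2) ≠ 0
  lines : ∀ k, W k ⬝ᵥ W (k + 1) ⨯₃ W (k + 2) ≠ 0

namespace IsNormalized

variable {U W : ℕ → Fin 3 → ℝ}

theorem lines_mul_points (h : IsNormalized U W) (k : ℕ) :
    (W k ⬝ᵥ W (k + 1) ⨯₃ W (k + 2)) * (U k ⬝ᵥ U (k + 1) ⨯₃ U (k + 2)) =
      (W k ⬝ᵥ U (k + 2) - 1) ^ 2 := by
  rw [triple_mul_triple, h.pair_self, h.pair_self, h.pair_self, h.pair_succ, h.pair_succ,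
    h.succ_pair, h.succ_pair]
  linear_combination (1 - W k ⬝ᵥ U (k + 2)) * h.add_eq_two k

theorem lines_mul_points_succ (h : IsNormalized U W) (k : ℕ) :
    (W k ⬝ᵥ W (k + 1) ⨯₃ W (k + 2)) * (U (k + 1) ⬝ᵥ U (k + 2) ⨯₃ U (k + 3)) =
      (W k ⬝ᵥ U (k + 2) - 1) * (W (k + 1) ⬝ᵥ U (k + 3) - 1) := by
  rw [triple_mul_triple, h.pair_self, h.pair_self, h.pair_succ, h.pair_succ, h.pair_succ,
    h.succ_pair]
  ring

theorem pair_sub_one_ne_zero (h : IsNormalized U W) (k : ℕ) : W k ⬝ᵥ U (k + 2) - 1 ≠ 0 := by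
  have := mul_ne_zero (h.lines k) (h.points k)
  rw [h.lines_mul_points] at this
  exact pow_ne_zero_iff two_ne_zero |>.mp this

/-- The ratio of `det (U k, U (k + 1), U (k + 2))` and `W k ⬝ᵥ U (k + 2) - 1` is constant. -/
theorem points_mul (h : IsNormalized U W) (k : ℕ) :
    (U k ⬝ᵥ U (k + 1) ⨯₃ U (k + 2)) * (W 0 ⬝ᵥ U 2 - 1) =
      (U 0 ⬝ᵥ U 1 ⨯₃ U 2) * (W k ⬝ᵥ U (k + 2) - 1) := by
  induction k with
  | zero => rfl
  | succ k ih =>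
    refine mul_left_cancel₀ (mul_ne_zero (h.lines k) (h.pair_sub_one_ne_zero k)) ?_
    have e₁ := h.lines_mul_points k
    have e₂ := h.lines_mul_points_succ k
    linear_combination (W 0 ⬝ᵥ U 2 - 1) * (W k ⬝ᵥ U (k + 2) - 1) * e₂
      - (W 0 ⬝ᵥ U 2 - 1) * (W (k + 1) ⬝ᵥ U (k + 3) - 1) * e₁
      + (W k ⬝ᵥ W (k + 1) ⨯₃ W (k + 2)) * (W (k + 1) ⬝ᵥ U (k + 3) - 1) * ih

/-- The linear dependence of four consecutive vertices, paired with the four edges of the same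
indices, determines the sum of the pairings at distance three. -/
theorem pair_add_three (h : IsNormalized U W) (k : ℕ) :
    W k ⬝ᵥ U (k + 3) + W (k + 3) ⬝ᵥ U k =
      2 + (W k ⬝ᵥ U (k + 2) - 1) * (W (k + 1) ⬝ᵥ U (k + 3) - 1) := by
  have hdep : ¬ LinearIndependent ℝ (fun j : Fin 4 => U (k + j)) := fun hli => by
    simpa using hli.fintype_card_le_finrank
  rw [Fintype.not_linearIndependent_iff] at hdep
  obtain ⟨g, hg, i, hi⟩ := hdep
  simp only [Fin.sum_univ_four] at hg
  have key : ∀ w : Fin 3 → ℝ, g 0 * (w ⬝ᵥ U k) + g 1 * (w ⬝ᵥ U (k + 1)) +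
      g 2 * (w ⬝ᵥ U (k + 2)) + g 3 * (w ⬝ᵥ U (k + 3)) = 0 := fun w => by
    have := congrArg (w ⬝ᵥ ·) hg
    simpa [dotProduct_add, dotProduct_smul] using this
  have k₀ := key (W k)
  have k₁ := key (W (k + 1))
  have k₂ := key (W (k + 2))
  have k₃ := key (W (k + 3))
  have hx := h.pair_sub_one_ne_zero k
  have a₀ := h.add_eq_two k
  have a₁ := h.add_eq_two (k + 1)
  simp only [add_assoc, Nat.reduceAdd] at a₁
  rw [h.pair_self, h.pair_succ] at k₀
  rw [h.pair_self, h.succ_pair, h.pair_succ] at k₁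
  rw [h.pair_self, h.succ_pair, h.pair_succ] at k₂
  rw [h.pair_self, h.succ_pair] at k₃
  have hy := h.pair_sub_one_ne_zero (k + 1)
  simp only [add_assoc, Nat.reduceAdd] at hy
  rw [show W (k + 2) ⬝ᵥ U k = 2 - W k ⬝ᵥ U (k + 2) by linarith] at k₂
  rw [show W (k + 3) ⬝ᵥ U (k + 1) = 2 - W (k + 1) ⬝ᵥ U (k + 3) by linarith] at k₃
  clear key a₀ a₁
  generalize W k ⬝ᵥ U (k + 2) = p at *
  generalize W (k + 1) ⬝ᵥ U (k + 3) = q at *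
  generalize W k ⬝ᵥ U (k + 3) = r at *
  generalize W (k + 3) ⬝ᵥ U k = s at *
  -- Three consecutive vertices are linearly independent.
  have g₃ : g 3 ≠ 0 := by
    intro h₃
    have h₀ : g 0 = 0 := (mul_eq_zero.mp (show (p - 1) * g 0 = 0 by
      linear_combination k₁ - k₂ + (1 - q) * h₃)).resolve_left hx
    have h₂ : g 2 = 0 := (mul_eq_zero.mp (show (p - 1) * g 2 = 0 by
      linear_combination k₀ - k₁ + (q - r) * h₃)).resolve_left hx
    have h₁ : g 1 = 0 := by linear_combination k₁ - h₀ - h₂ - q * h₃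
    fin_cases i <;> contradiction
  refine mul_left_cancel₀ (mul_ne_zero hy g₃) ?_
  linear_combination -(p - 1) * (k₃ - k₁) + (s - 1) * (k₁ - k₂) - (q - 1) * (p - 1) * k₁
    + (q - 1) * (k₁ - k₂) + (q - 1) * (k₀ - k₁)

/-- Normalized sequences which are quasi-periodic of period `n`, as those of a closed `n`-gon, are
periodic. -/
theorem eq_one_of_quasiperiodic (h : IsNormalized U W) {n : ℕ} {c : ℝ} (hc : c ≠ 0)
    (hU : ∀ k, U (k + n) = c • U k) (hW : ∀ k, W (k + n) = c⁻¹ • W k) : c = 1 := by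
  have e := h.points_mul n
  rw [show U n = c • U 0 by simpa using hU 0, show W n = c⁻¹ • W 0 by simpa using hW 0,
    show n + 1 = 1 + n by ring, show n + 2 = 2 + n by ring, hU, hU] at e
  simp only [map_smul, LinearMap.smul_apply, dotProduct_smul, smul_dotProduct, smul_eq_mul,
    mul_inv_cancel_left₀ hc] at e
  have hD : (U 0 ⬝ᵥ U 1 ⨯₃ U 2) * (W 0 ⬝ᵥ U 2 - 1) ≠ 0 :=
    mul_ne_zero (h.points 0) (h.pair_sub_one_ne_zero 0)
  have e' : (c ^ 3 - 1) * ((U 0 ⬝ᵥ U 1 ⨯₃ U 2) * (W 0 ⬝ᵥ U 2 - 1)) = 0 := by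
    linear_combination e
  have e₃ : (c - 1) * (c ^ 2 + c + 1) = 0 := by
    linear_combination (mul_eq_zero.mp e').resolve_right hD
  have : c ^ 2 + c + 1 ≠ 0 := by nlinarith [sq_nonneg (2 * c + 1)]
  linarith [(mul_eq_zero.mp e₃).resolve_right this]

theorem six_le_of_quasiperiodic (h : IsNormalized U W) {n : ℕ} (hn : 2 ≤ n) {c : ℝ} (hc : c ≠ 0)
    (hU : ∀ k, U (k + n) = c • U k) (hW : ∀ k, W (k + n) = c⁻¹ • W k) : 6 ≤ n := by
  obtain rfl := h.eq_one_of_quasiperiodic hc hU hW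
  simp only [inv_one, one_smul] at hU hW
  by_contra! hlt
  have e := h.pair_add_three 0
  have hx := mul_ne_zero (h.pair_sub_one_ne_zero 0) (h.pair_sub_one_ne_zero 1)
  have hsum : W 0 ⬝ᵥ U 3 + W 3 ⬝ᵥ U 0 = 2 := by
    -- Distance three becomes cyclic distance `1`, `0`, `1`, `2` for `n = 2`, `3`, `4`, `5`.
    interval_cases n
    · rw [show U 3 = U 1 from hU 1, show W 3 = W 1 from hW 1, h.pair_succ, h.succ_pair]; norm_num
    · rw [show U 3 = U 0 from hU 0, show W 3 = W 0 from hW 0, h.pair_self]; norm_num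
    · rw [← show W 4 = W 0 from hW 0, ← show U 4 = U 0 from hU 0, h.succ_pair, h.pair_succ]
      norm_num
    · rw [← show W 5 = W 0 from hW 0, ← show U 5 = U 0 from hU 0, add_comm]
      exact h.add_eq_two 3
  apply hx
  simp only [zero_add] at e ⊢
  linarith

end IsNormalized

/-- The factors that bring the homogeneous coordinates `u`, `w` of a closed polygon into normalized
form: they are determined by `W k ⬝ᵥ U k = W k ⬝ᵥ U (k + 1) = 1`. -/
noncomputable def scale {n : ℕ} (u w : ZMod n → Fin 3 → ℝ) : ℕ → ℝ
  | 0 => 1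
  | k + 1 => scale u w k * (w k ⬝ᵥ u k) / (w k ⬝ᵥ u (k + 1))

/-- Going once around the polygon multiplies the scaling factors by a constant. -/
theorem scale_add {n : ℕ} (u w : ZMod n → Fin 3 → ℝ) (k : ℕ) :
    scale u w (k + n) = scale u w n * scale u w k := by
  induction k with
  | zero => simp [scale]
  | succ k ih =>
    rw [add_right_comm, scale, ih, scale]
    simp only [Nat.cast_add, CharP.cast_eq_zero, add_zero]
    ring

theorem six_le_of_isDancingTriple {n : ℕ} (hn : 2 ≤ n) (u w : ZMod n → Fin 3 → ℝ)
    (h : ∀ i, IsDancingTriple (u i) (u (i + 1)) (u (i + 2)) (w i) (w (i + 1)) (w (i + 2))) :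
    6 ≤ n := by
  have hne : ∀ i, w i ⬝ᵥ u (i + 1) ≠ 0 := fun i hi =>
    mul_ne_zero (h i).ne₀ (h i).ne₁ (by rw [(h i).inscribed₀, hi, zero_mul])
  have hs : ∀ k, scale u w k ≠ 0 := by
    intro k
    induction k with
    | zero => simp [scale]
    | succ k ih => exact div_ne_zero (mul_ne_zero ih (h k).ne₀) (hne k)
  have hs₁ : ∀ k : ℕ, scale u w (k + 1) * (w k ⬝ᵥ u (k + 1)) = scale u w k * (w k ⬝ᵥ u k) :=
    fun k => div_mul_cancel₀ _ (hne k)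
  have hN : IsNormalized (fun k => scale u w k • u k)
      (fun k => (scale u w k * (w k ⬝ᵥ u k))⁻¹ • w k) := by
    refine ⟨fun k => ?_, fun k => ?_, fun k => ?_, fun k => ?_, fun k => ?_, fun k => ?_⟩
    all_goals
      have t₀ := hs k
      have t₁ := hs (k + 1)
      have t₂ := hs (k + 2)
      have s₁ := hs₁ k
      have s₂ := hs₁ (k + 1)
      obtain ⟨n₀, n₁, n₂, hp, hl, i₀, i₁, hd⟩ := h k
      have n₀₁ := hne k
      have n₂₁ : w (k + 2) ⬝ᵥ u (k + 1) ≠ 0 := fun hi =>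
        mul_ne_zero n₁ n₂ (by rw [i₁, hi, mul_zero])
      simp only [Nat.cast_add, Nat.cast_one, Nat.cast_ofNat, add_assoc, one_add_one_eq_two]
        at s₂ ⊢
      simp only [map_smul, LinearMap.smul_apply, dotProduct_smul, smul_dotProduct, smul_eq_mul]
    · field_simp
    · field_simp
      linear_combination s₁
    · field_simp
      refine mul_right_cancel₀ n₀₁ ?_
      linear_combination -(w (k + 1) ⬝ᵥ u (k + 1)) * s₁ - scale u w k * i₀
    · -- With both scaling steps and the inscription at `k + 1`, the sum of pairings becomes the
      -- expression in `hd`.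
      have e : scale u w (k + 2) * ((w k ⬝ᵥ u (k + 1)) * (w (k + 2) ⬝ᵥ u (k + 2))) =
          scale u w k * ((w k ⬝ᵥ u k) * (w (k + 2) ⬝ᵥ u (k + 1))) := by
        refine mul_right_cancel₀ n₁ ?_
        linear_combination (scale u w (k + 2) * (w k ⬝ᵥ u (k + 1))) * i₁ +
          (w k ⬝ᵥ u (k + 1)) * (w (k + 2) ⬝ᵥ u (k + 1)) * s₂ +
          (w (k + 2) ⬝ᵥ u (k + 1)) * (w (k + 1) ⬝ᵥ u (k + 1)) * s₁
      rw [← eq_div_iff (mul_ne_zero n₀₁ n₂)] at e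
      rw [e, ← hd]
      field_simp
      ring
    · positivity
    · positivity
  refine hN.six_le_of_quasiperiodic hn (hs n) (fun k => ?_) (fun k => ?_)
  · simp [scale_add, smul_smul]
  · simp [scale_add, smul_smul, mul_assoc, mul_comm]

/-! ### Gluing closed words of flags -/

/-- Thirteen pairs of a point and a line, in integral homogeneous coordinates. -/
def flag : Fin 13 → (Fin 3 → ℤ) × (Fin 3 → ℤ) :=
  ![(![1, 0, 0], ![1, 1, 0]), (![0, 1, 0], ![1, 1, 1]), (![1, 2, -2], ![-1, 1, 0]),
    (![-1, 0, 1], ![1, 2, 2]), (![1, 1, -1], ![0, 2, 1]), (![1, 0, 1], ![1, 0, 0]),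
    (![-1, 1, 0], ![0, 1, 1]), (![1, 1, 0], ![0, 1, -1]), (![-1, 2, 1], ![1, 0, 2]),
    (![2, 0, 1], ![1, 2, -1]), (![1, 1, 2], ![0, -1, 1]), (![0, 2, 1], ![1, 0, 1]),
    (![1, -1, 0], ![2, 1, -1])]

/-- The pairing of the line of the flag `a` with the point of the flag `b`. -/
def pairing (a b : Fin 13) : ℤ := (flag a).2 ⬝ᵥ (flag b).1

/-- The flags `a`, `b`, `c` are three consecutive terms of a normalized dancing pair. -/
def IsStep (a b c : Fin 13) : Prop :=
  pairing a b = 1 ∧ pairing b a = 1 ∧ pairing b c = 1 ∧ pairing c b = 1 ∧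
    pairing a c + pairing c a = 2 ∧ pairing a c ≠ 1

instance (a b c : Fin 13) : Decidable (IsStep a b c) := by
  unfold IsStep
  infer_instance

theorem pairing_self : ∀ a, pairing a a = 1 := by decide

/-- The point of a flag, in real homogeneous coordinates. -/
def flagPoint (a : Fin 13) : Fin 3 → ℝ := fun i => (flag a).1 i

/-- The line of a flag, in real homogeneous coordinates. -/
def flagLine (a : Fin 13) : Fin 3 → ℝ := fun i => (flag a).2 i

theorem flagLine_dotProduct_flagPoint (a b : Fin 13) :
    flagLine a ⬝ᵥ flagPoint b = pairing a b := by
  simp [flagLine, flagPoint, pairing, dotProduct]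

theorem flagPoint_ne_zero (a : Fin 13) : flagPoint a ≠ 0 := fun h => by
  simpa [h, pairing_self] using flagLine_dotProduct_flagPoint a a

theorem flagLine_ne_zero (a : Fin 13) : flagLine a ≠ 0 := fun h => by
  simpa [h, pairing_self] using flagLine_dotProduct_flagPoint a a

theorem IsStep.isDancingTriple {a b c : Fin 13} (h : IsStep a b c) :
    IsDancingTriple (flagPoint a) (flagPoint b) (flagPoint c)
      (flagLine a) (flagLine b) (flagLine c) := by
  obtain ⟨h₁, h₂, h₃, h₄, h₅, h₆⟩ := h
  have h₅' : (pairing a c : ℝ) + pairing c a = 2 := by exact_mod_cast h₅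
  have h₆' : (pairing a c : ℝ) - 1 ≠ 0 := sub_ne_zero.mpr (by exact_mod_cast h₆)
  -- As in `IsNormalized.lines_mul_points`, the product of the two determinants is a square.
  have hdet : (flagLine a ⬝ᵥ flagLine b ⨯₃ flagLine c) *
      (flagPoint a ⬝ᵥ flagPoint b ⨯₃ flagPoint c) = (pairing a c - 1) ^ 2 := by
    simp only [triple_mul_triple, flagLine_dotProduct_flagPoint, pairing_self, h₁, h₂, h₃, h₄,
      Int.cast_one]
    linear_combination (1 - (pairing a c : ℝ)) * h₅'
  have hdet' := pow_ne_zero 2 h₆'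
  rw [← hdet] at hdet'
  refine ⟨?_, ?_, ?_, right_ne_zero_of_mul hdet', left_ne_zero_of_mul hdet', ?_, ?_, ?_⟩ <;>
    simp only [flagLine_dotProduct_flagPoint, pairing_self, h₁, h₂, h₃, h₄, Int.cast_one] <;>
    norm_num
  linarith

/-- Closed words of flags of every length `n ≥ 6`, starting with the flags `0` and `1`. Since each
step involves three consecutive flags, two words with the same first two flags can be concatenated,
so that a word of length `6` may be put in front of any other one. -/
theorem exists_closed_word {n : ℕ} (hn : 6 ≤ n) :
    ∃ f : ℕ → Fin 13, f 0 = 0 ∧ f 1 = 1 ∧ f n = 0 ∧ f (n + 1) = 1 ∧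
      ∀ i < n, IsStep (f i) (f (i + 1)) (f (i + 2)) := by
  induction n using Nat.strong_induction_on with | _ n ih =>
  by_cases h12 : n < 12
  · interval_cases n
    · exact ⟨fun i => [0, 1, 2, 3, 4, 5, 0, 1].getD i 0, by decide⟩
    · exact ⟨fun i => [0, 1, 2, 3, 6, 7, 8, 0, 1].getD i 0, by decide⟩
    · exact ⟨fun i => [0, 1, 2, 3, 6, 9, 10, 5, 0, 1].getD i 0, by decide⟩
    · exact ⟨fun i => [0, 1, 2, 3, 6, 7, 11, 12, 5, 0, 1].getD i 0, by decide⟩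
    · exact ⟨fun i => [0, 1, 2, 3, 4, 5, 12, 11, 7, 8, 0, 1].getD i 0, by decide⟩
    · exact ⟨fun i => [0, 1, 2, 3, 4, 5, 10, 9, 6, 7, 8, 0, 1].getD i 0, by decide⟩
  · obtain ⟨m, rfl⟩ : ∃ m, n = m + 6 := ⟨n - 6, by omega⟩
    obtain ⟨f, h₀, h₁, hm, hm₁, hf⟩ := ih m (by omega) (by omega)
    refine ⟨fun i => if i < 6 then [0, 1, 2, 3, 4, 5].getD i 0 else f (i - 6), rfl, rfl, ?_, ?_,
      fun i hi => ?_⟩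
    · simpa using hm
    · simpa [show ¬ m + 6 + 1 < 6 by omega, show m + 6 + 1 - 6 = m + 1 by omega] using hm₁
    · by_cases h6 : 6 ≤ i
      · obtain ⟨j, rfl⟩ : ∃ j, i = j + 6 := ⟨i - 6, by omega⟩
        have := hf j (by omega)
        simpa [show ¬ j + 6 + 1 < 6 by omega, show j + 6 + 1 - 6 = j + 1 by omega,
          show ¬ j + 6 + 2 < 6 by omega, show j + 6 + 2 - 6 = j + 2 by omega] using this
      · interval_cases i <;> simp [h₀, h₁] <;> decide

/-- A closed word of length `n`, read as a function on `ZMod n`. -/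
theorem exists_cyclic_word {n : ℕ} (hn : 6 ≤ n) :
    ∃ a : ZMod n → Fin 13, ∀ i, IsStep (a i) (a (i + 1)) (a (i + 2)) := by
  obtain ⟨f, h₀, h₁, hn₀, hn₁, hf⟩ := exists_closed_word hn
  have : NeZero n := ⟨by omega⟩
  refine ⟨fun i => f i.val, fun i => ?_⟩
  have hi := ZMod.val_lt i
  have v₁ : (1 : ZMod n).val = 1 := ZMod.val_one'' (by omega)
  have v₂ : (2 : ZMod n).val = 2 := ZMod.val_ofNat_of_lt (show 2 < n by omega)
  have e₁ : f (i + 1).val = f (i.val + 1) := by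
    rw [ZMod.val_add, v₁]
    rcases (show i.val + 1 < n ∨ i.val + 1 = n by omega) with h | h
    · rw [Nat.mod_eq_of_lt h]
    · rw [h, Nat.mod_self, h₀, hn₀]
  have e₂ : f (i + 2).val = f (i.val + 2) := by
    rw [ZMod.val_add, v₂]
    rcases (show i.val + 2 < n ∨ i.val + 2 = n ∨ i.val + 2 = n + 1 by omega) with h | h | h
    · rw [Nat.mod_eq_of_lt h]
    · rw [h, Nat.mod_self, h₀, hn₀]
    · rw [h, Nat.add_mod_left, Nat.mod_eq_of_lt (by omega), h₁, hn₁]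
  simpa only [e₁, e₂] using hf _ hi

end DancingPairs

theorem theorem1p1 (n : ℕ) (hn : 2 ≤ n) :
    (∃ (A : ZMod n → DancingPairs.Point) (b : ZMod n → DancingPairs.Line),
      DancingPairs.IsNondegenerate A b ∧ DancingPairs.IsDancing A b) ↔ 6 ≤ n := by
  constructor
  · rintro ⟨A, b, h⟩
    refine DancingPairs.six_le_of_isDancingTriple hn (fun i => (A i).rep) (fun i => (b i).rep)
      ((DancingPairs.isNondegenerate_and_isDancing_iff _ _ (fun i => (A i).rep_nonzero)
        (fun i => (b i).rep_nonzero)).mp ?_)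
    simpa only [Projectivization.mk_rep] using h
  · intro h6
    obtain ⟨a, ha⟩ := DancingPairs.exists_cyclic_word h6
    exact ⟨_, _, (DancingPairs.isNondegenerate_and_isDancing_iff
      (fun i => DancingPairs.flagPoint (a i)) (fun i => DancingPairs.flagLine (a i))
      (fun i => DancingPairs.flagPoint_ne_zero _) (fun i => DancingPairs.flagLine_ne_zero _)).mpr
      fun i => (ha i).isDancingTriple⟩
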